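/- Let $G=(V,E)$ be a finite simple graph on $n=|V|$ vertices. For a finite simple graph $H$ with vertex set $U$, unweighted or with nonnegative edge weights, let $L_H=D_H-A_H$ be its (weighted) Laplacian, where $A_H$ is the (weighted) adjacency matrix and $D_H$ the diagonal matrix of (weighted) degrees, and let $$\mathrm{SDP}(H)=\max\Big\{\tfrac14\sum_{i,j\in U}(L_H)_{ij}X_{ij}\ :\ X\in\mathbb R^{U\times U},\ X\succeq 0,\ X_{ii}=1\text{ for all } i\in U\Big\}$$ be the optimal value of the Goemans–Williamson relaxation of max-cut (with value $0$ if $U=\emptyset$). For $S\subseteq V$ let $G[S]$ be the induced subgraph, with the restricted weights in the weighted case. Let $0<t\le n$ be real, let $S_t$ be a random subset of $V$ that contains each vertex independently with probability $t/n$, and let $0<\delta\le 1$. (1) (Unweighted.) With probability at least $1-\delta$ over the draw of $S_t$, $$\left|\frac{1}{n^2}\mathrm{SDP}(G)-\frac{1}{t^2}\mathrm{SDP}(G[S_t])\right|\le \frac{n-t}{n^2t}\left(\mathrm{SDP}(G)-\frac{|E|}{2}\right)+\sqrt{\frac{n^3}{t^4}\log\left(\frac{2}{\delta}\right)}.$$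 (2) (Weighted.) If $G$ carries edge weights $w_e\ge 0$ $(e\in E)$ and $W=\sum_{e\in E}w_e$, then, with $\mathrm{SDP}$ taken with respect to the weights, with probability at least $1-\delta$ over the draw of $S_t$, $$\left|\frac{1}{n^2}\mathrm{SDP}(G)-\frac{1}{t^2}\mathrm{SDP}(G[S_t])\right|\le \frac{n-t}{n^2t}\left(\mathrm{SDP}(G)-\frac{W}{2}\right)+\frac{W}{t^2}\sqrt{\log\left(\frac{2}{\delta}\right)}.$$ -/

import Mathlib

open MeasureTheory ProbabilityTheory

namespace MaxCutSDP

/-- Feasible matrices of the Goemans-Williamson relaxation: real positive semidefinite matrices with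
unit diagonal. -/
def feasible (V : Type*) : Set (Matrix V V ℝ) :=
  {X | X.PosSemidef ∧ ∀ i, X i i = 1}

/-- The objective `1/4 * (L • X)`, with the entrywise (Frobenius) inner product of matrices. -/
noncomputable def objective {V : Type*} [Fintype V] (L X : Matrix V V ℝ) : ℝ :=
  1 / 4 * ∑ i, ∑ j, L i j * X i j

/-- Optimal value of the Goemans-Williamson relaxation for the Laplacian `L`.
The supremum is a maximum, see `isGreatest_value`. -/
noncomputable def value {V : Type*} [Fintype V] (L : Matrix V V ℝ) : ℝ :=
  sSup (objective L '' feasible V)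

/-- The value of the relaxation is attained by a feasible matrix. -/
theorem isGreatest_value {V : Type*} [Fintype V] (L : Matrix V V ℝ) :
    IsGreatest (objective L '' feasible V) (value L) := by
  classical
  have hne : (feasible V).Nonempty :=
    ⟨1, Matrix.PosSemidef.one, fun i => Matrix.one_apply_eq i⟩
  have hcl : IsClosed (feasible V) := by
    have : feasible V = {X : Matrix V V ℝ | X.IsHermitian} ∩
        (⋂ x : V → ℝ, {X : Matrix V V ℝ | 0 ≤ star x ⬝ᵥ (X.mulVec x)}) ∩
        (⋂ i, {X : Matrix V V ℝ | X i i = 1}) := by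
      ext X
      simp [feasible, Matrix.posSemidef_iff_dotProduct_mulVec]
    rw [this]
    refine (IsClosed.inter ?_ (isClosed_iInter fun x => ?_)).inter (isClosed_iInter fun i => ?_)
    · exact isClosed_eq (by fun_prop) continuous_id
    · exact isClosed_le continuous_const (by fun_prop)
    · exact isClosed_eq (by fun_prop) continuous_const
  have hsub : feasible V ⊆ Set.pi Set.univ fun _ : V => Set.pi Set.univ fun _ : V =>
      Set.Icc (-1 : ℝ) 1 := by
    rintro X ⟨hX, h1⟩ i - j -
    have hs : X j i = X i j := by simpa using hX.1.apply i j
    have key : ∀ c : ℝ, c * c = 1 → 0 ≤ 2 + 2 * c * X i j := by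
      intro c hc
      have := (Matrix.posSemidef_iff_dotProduct_mulVec.1 hX).2 (Pi.single i 1 + Pi.single j c)
      simp [Matrix.mulVec_add, add_dotProduct, dotProduct_add, h1, hs] at this
      nlinarith
    have h2 := key 1 (by norm_num)
    have h3 := key (-1) (by norm_num)
    constructor <;> linarith
  have hcpt : IsCompact (feasible V) :=
    (isCompact_univ_pi fun _ => isCompact_univ_pi fun _ => isCompact_Icc).of_isClosed_subset
      hcl hsub
  exact (hcpt.image (f := objective L) (by unfold objective; fun_prop)).isGreatest_sSup
    (hne.image _)

open Classical in
/-- `SDP(G)` for an unweighted graph. -/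
noncomputable def sdp {V : Type*} [Fintype V] (G : SimpleGraph V) : ℝ :=
  value (G.lapMatrix ℝ)

open Classical in
/-- `SDP(G[S])` for an unweighted graph. -/
noncomputable def sdpOn {V : Type*} [Fintype V] (G : SimpleGraph V) (S : Set V) : ℝ :=
  sdp (G.induce S)

open Classical in
/-- Weighted adjacency matrix; only the values of `w` on edges of `G` matter. -/
noncomputable def weightedAdj {V : Type*} (G : SimpleGraph V) (w : Sym2 V → ℝ) : Matrix V V ℝ :=
  Matrix.of fun i j => if G.Adj i j then w s(i, j) else 0

open Classical in
/-- Weighted Laplacian: diagonal matrix of weighted degrees minus weighted adjacency matrix. -/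
noncomputable def weightedLap {V : Type*} [Fintype V] (G : SimpleGraph V) (w : Sym2 V → ℝ) :
    Matrix V V ℝ :=
  Matrix.diagonal (fun i => ∑ j, weightedAdj G w i j) - weightedAdj G w

/-- `SDP(G)` for a weighted graph. -/
noncomputable def weightedSdp {V : Type*} [Fintype V] (G : SimpleGraph V) (w : Sym2 V → ℝ) : ℝ :=
  value (weightedLap G w)

open Classical in
/-- `SDP(G[S])` for a weighted graph, the induced subgraph carrying the restricted weights. -/
noncomputable def weightedSdpOn {V : Type*} [Fintype V] (G : SimpleGraph V) (w : Sym2 V → ℝ)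
    (S : Set V) : ℝ :=
  weightedSdp (G.induce S) (fun e => w (e.map Subtype.val))

open Classical in
/-- Total edge weight `W`. -/
noncomputable def totalWeight {V : Type*} [Fintype V] (G : SimpleGraph V) (w : Sym2 V → ℝ) : ℝ :=
  ∑ e ∈ G.edgeFinset, w e

end MaxCutSDP

/-! Write F(T) = SDP(G[T]), p = t/n and W for the total weight. The bound is a bias estimate for E F
plus concentration of F around its mean. By restriction and block extension, F(T) is the maximum of
`cutForm A T X` over feasible X on all of V, so every T shares one feasible set. Bias from below: a
fixed optimal X for G is a candidate for every T, and each edge survives with probability p², so p²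
SDP(G) ≤ E F. From above: if X_T is optimal for T and D_T is the diagonal 0/1 matrix of T, then Z =
p⁻¹ E[D_T X_T D_T] is feasible, since Z_ii = p⁻¹ P(i ∈ T) = 1. Comparing `cutForm` at Z with E F
gives E F ≤ p SDP(G) - p(1-p) W/2. After division by t² the two bounds differ by exactly the stated
bias term. Concentration: entries of X lie in [-1,1], so inserting a vertex changes F by at most its
weighted degree, and the bounded differences inequality applies. The squared degrees sum to at most
n³ in the unweighted case and 2W² in the weighted case. -/

namespace MaxCutSDP

/-! ### Exponential moments under independent sampling -/

/-- Hoeffding's lemma for a two-point distribution. -/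
lemma two_point_exp_le {p : ℝ} (hp0 : 0 ≤ p) (hp1 : p ≤ 1) (x y : ℝ) :
    p * Real.exp x + (1 - p) * Real.exp y ≤
      Real.exp (p * x + (1 - p) * y + (x - y) ^ 2 / 8) := by
  set ν : Measure ℝ :=
    ENNReal.ofReal p • Measure.dirac x + ENNReal.ofReal (1 - p) • Measure.dirac y with hν
  have : IsProbabilityMeasure ν := ⟨by
    simp [hν, ← ENNReal.ofReal_add hp0 (sub_nonneg.2 hp1)]⟩
  have hint (g : ℝ → ℝ) : ∫ z, g z ∂ν = p * g x + (1 - p) * g y := by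
    have hi (z q : ℝ) : Integrable g (ENNReal.ofReal q • Measure.dirac z) :=
      (integrable_dirac (by simp)).smul_measure ENNReal.ofReal_ne_top
    rw [hν, integral_add_measure (hi _ _) (hi _ _)]
    simp [integral_smul_measure, hp0, hp1]
  have hb : ∀ᵐ z ∂ν, (id z : ℝ) ∈ Set.Icc (min x y) (max x y) := by
    have hm : MeasurableSet {z : ℝ | ¬ (z ∈ Set.Icc (min x y) (max x y))} :=
      measurableSet_Icc.compl
    rw [ae_iff, hν]
    simp only [id, Measure.coe_add, Measure.coe_smul, Pi.add_apply, Pi.smul_apply,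
      Measure.dirac_apply' _ hm]
    simp
  have h := (hasSubgaussianMGF_of_mem_Icc (μ := ν) aemeasurable_id hb).mgf_le 1
  simp only [mgf, one_mul, id] at h
  rw [hint (fun z => z), hint] at h
  have hsq : (max x y - min x y) ^ 2 = (x - y) ^ 2 := by
    rw [max_sub_min_eq_abs, sq_abs]; ring
  have h8 : ((((‖max x y - min x y‖₊ / 2) ^ 2 : NNReal) : ℝ) * 1 ^ 2 / 2) = (x - y) ^ 2 / 8 := by
    push_cast
    rw [div_pow, Real.norm_eq_abs, sq_abs, hsq]; ring
  rw [h8] at h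
  have h' := mul_le_mul_of_nonneg_left h (Real.exp_pos (p * x + (1 - p) * y)).le
  rw [← Real.exp_add] at h'
  refine le_of_eq_of_le ?_ h'
  rw [mul_add, mul_left_comm, mul_left_comm _ (1 - p), ← Real.exp_add, ← Real.exp_add]
  simp

section Sampling

variable {V : Type*} [DecidableEq V]

/-- Expectation of `f T` when `T ⊆ s` contains each element independently with probability `p`. -/
def sampleMean (p : ℝ) (s : Finset V) (f : Finset V → ℝ) : ℝ :=
  ∑ T ∈ s.powerset, (∏ i ∈ s, if i ∈ T then p else 1 - p) * f T

lemma sampleMean_empty (p : ℝ) (f : Finset V → ℝ) : sampleMean p ∅ f = f ∅ := by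
  simp [sampleMean]

/-- Fubini in one coordinate: average over the membership of a first. Inductions on the ground set
rest on this. -/
lemma sampleMean_insert (p : ℝ) {a : V} {s : Finset V} (ha : a ∉ s) (f : Finset V → ℝ) :
    sampleMean p (insert a s) f =
      sampleMean p s (fun T => p * f (insert a T) + (1 - p) * f T) := by
  simp only [sampleMean]
  rw [Finset.sum_powerset_insert ha, ← Finset.sum_add_distrib]
  refine Finset.sum_congr rfl fun T hT => ?_
  have haT : a ∉ T := fun h => ha (Finset.mem_powerset.1 hT h)
  have hprod : (∏ i ∈ s, if i ∈ insert a T then p else 1 - p) =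
      ∏ i ∈ s, if i ∈ T then p else 1 - p := by
    refine Finset.prod_congr rfl fun i hi => ?_
    have : i ≠ a := fun h => ha (h ▸ hi)
    simp [this]
  rw [Finset.prod_insert ha, Finset.prod_insert ha, hprod]
  simp only [haT, if_false, Finset.mem_insert_self, if_true]
  ring

lemma sampleMean_mono {p : ℝ} (hp0 : 0 ≤ p) (hp1 : p ≤ 1) (s : Finset V) {f g : Finset V → ℝ}
    (h : ∀ T, f T ≤ g T) : sampleMean p s f ≤ sampleMean p s g := by
  refine Finset.sum_le_sum fun T _ => mul_le_mul_of_nonneg_left (h T) ?_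
  refine Finset.prod_nonneg fun i _ => ?_
  split_ifs <;> linarith

lemma sampleMean_mul_const (p : ℝ) (s : Finset V) (f : Finset V → ℝ) (c : ℝ) :
    sampleMean p s (fun T => f T * c) = sampleMean p s f * c := by
  simp only [sampleMean, Finset.sum_mul, mul_assoc]

/-- Exponential moment bound for functions with bounded differences. -/
lemma sampleMean_exp_le {p : ℝ} (hp0 : 0 ≤ p) (hp1 : p ≤ 1) (c : V → ℝ) (s : Finset V)
    (f : Finset V → ℝ) (hf : ∀ a T, |f (insert a T) - f T| ≤ c a) :
    sampleMean p s (fun T => Real.exp (f T)) ≤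
      Real.exp (sampleMean p s f + (∑ a ∈ s, c a ^ 2) / 8) := by
  induction s using Finset.induction_on generalizing f with
  | empty => simp [sampleMean_empty]
  | insert a s ha ih =>
    rw [sampleMean_insert p ha, sampleMean_insert p ha, Finset.sum_insert ha]
    -- Conditional mean of f given the memberships other than that of a. As an average of two
    -- functions with differences bounded by c, it has the same bounds, so the induction hypothesis
    -- applies to it.
    set h : Finset V → ℝ := fun T => p * f (insert a T) + (1 - p) * f T with hh
    calc _ ≤ sampleMean p s (fun T => Real.exp (h T) * Real.exp (c a ^ 2 / 8)) := by
          refine sampleMean_mono hp0 hp1 s fun T => ?_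
          refine (two_point_exp_le hp0 hp1 _ _).trans ?_
          rw [← Real.exp_add, Real.exp_le_exp]
          have := sq_le_sq' (neg_le_of_abs_le (hf a T)) (le_of_abs_le (hf a T))
          simp only [hh]
          linarith
      _ = sampleMean p s (fun T => Real.exp (h T)) * Real.exp (c a ^ 2 / 8) :=
          sampleMean_mul_const _ _ _ _
      _ ≤ Real.exp (sampleMean p s h + (∑ a ∈ s, c a ^ 2) / 8) * Real.exp (c a ^ 2 / 8) := by
          refine mul_le_mul_of_nonneg_right (ih h fun b T => ?_) (Real.exp_pos _).le
          have h1 := hf b (insert a T)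
          have h2 := hf b T
          rw [abs_le] at h1 h2 ⊢
          simp only [hh, Finset.insert_comm a b]
          constructor <;> nlinarith
      _ = _ := by rw [← Real.exp_add]; ring_nf

end Sampling

/-! ### Law of the random set and the bounded differences inequality -/

section Law

variable {V : Type*} [Fintype V] {Ω : Type*}

open Classical in
/-- The random set as a finset. -/
noncomputable def sampled (S : Ω → Set V) (ω : Ω) : Finset V := Finset.univ.filter (· ∈ S ω)

lemma mem_sampled {S : Ω → Set V} {ω : Ω} {i : V} : i ∈ sampled S ω ↔ i ∈ S ω := by
  simp [sampled]

lemma coe_sampled (S : Ω → Set V) (ω : Ω) : (sampled S ω : Set V) = S ω := by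
  ext; simp [sampled]

variable [MeasurableSpace Ω]

lemma measurableSet_sampled {S : Ω → Set V} (hmeas : ∀ i : V, MeasurableSet {ω | i ∈ S ω})
    (P : Finset V → Prop) : MeasurableSet {ω | P (sampled S ω)} := by
  classical
  have hfib (T : Finset V) : MeasurableSet {ω | sampled S ω = T} := by
    have : {ω | sampled S ω = T} = ⋂ i, {ω | i ∈ S ω ↔ i ∈ T} := by
      ext ω; simp [Finset.ext_iff, mem_sampled]
    rw [this]
    refine MeasurableSet.iInter fun i => ?_
    by_cases hi : i ∈ T
    · simpa [hi] using hmeas i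
    · have := (hmeas i).compl
      simp only [hi, iff_false]
      exact this
  have : {ω | P (sampled S ω)} = ⋃ T ∈ {T | P T}, {ω | sampled S ω = T} := by
    ext ω; simp
  rw [this]
  exact MeasurableSet.biUnion (Set.to_countable _) fun T _ => hfib T

variable [DecidableEq V] {μ : Measure Ω} {S : Ω → Set V} {p : ℝ}

lemma measureReal_sampled_eq [IsProbabilityMeasure μ]
    (hmeas : ∀ i : V, MeasurableSet {ω | i ∈ S ω})
    (hindep : iIndepSet (fun i : V => {ω | i ∈ S ω}) μ)
    (hprob : ∀ i : V, μ.real {ω | i ∈ S ω} = p) (T : Finset V) :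
    μ.real {ω | sampled S ω = T} = ∏ i, if i ∈ T then p else 1 - p := by
  have hset : {ω | sampled S ω = T} =
      ⋂ i, if i ∈ T then {ω | i ∈ S ω} else {ω | i ∈ S ω}ᶜ := by
    ext ω
    simp only [Set.mem_ofPred_eq, Set.mem_iInter, Finset.ext_iff, mem_sampled]
    refine forall_congr' fun i => ?_
    by_cases hi : i ∈ T <;> simp [hi]
  rw [measureReal_def, hset, (iIndepSet_iff_iIndep _ _).1 hindep |>.meas_iInter, ENNReal.toReal_prod]
  · refine Finset.prod_congr rfl fun i _ => ?_
    split_ifs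
    · exact hprob i
    · rw [← measureReal_def, probReal_compl_eq_one_sub (hmeas i), hprob]
  -- Independence is used for the generated σ-algebras, which contain the complements needed for i ∉
  -- T.
  · intro i
    have : MeasurableSet[MeasurableSpace.generateFrom {{ω | i ∈ S ω}}] {ω | i ∈ S ω} :=
      MeasurableSpace.measurableSet_generateFrom rfl
    split_ifs
    · exact this
    · exact this.compl

lemma measureReal_sampled [IsProbabilityMeasure μ]
    (hmeas : ∀ i : V, MeasurableSet {ω | i ∈ S ω})
    (hindep : iIndepSet (fun i : V => {ω | i ∈ S ω}) μ)
    (hprob : ∀ i : V, μ.real {ω | i ∈ S ω} = p) (P : Finset V → Prop)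
    [DecidablePred P] :
    μ.real {ω | P (sampled S ω)} =
      sampleMean p Finset.univ (fun T => if P T then 1 else 0) := by
  have hset : {ω | P (sampled S ω)} =
      ⋃ T ∈ Finset.univ.filter P, {ω | sampled S ω = T} := by
    ext ω; simp
  rw [hset, measureReal_biUnion_finset]
  · simp only [measureReal_sampled_eq hmeas hindep hprob, sampleMean, Finset.powerset_univ]
    rw [Finset.sum_filter]
    refine Finset.sum_congr rfl fun T _ => ?_
    split_ifs <;> simp
  · intro T _ U _ hTU
    exact Set.disjoint_left.2 fun ω h1 h2 => hTU (h1.symm.trans h2)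
  · exact fun T _ => measurableSet_sampled hmeas (· = T)

lemma measureReal_upper_tail_le [IsProbabilityMeasure μ] (hp0 : 0 ≤ p) (hp1 : p ≤ 1)
    (hmeas : ∀ i : V, MeasurableSet {ω | i ∈ S ω})
    (hindep : iIndepSet (fun i : V => {ω | i ∈ S ω}) μ)
    (hprob : ∀ i : V, μ.real {ω | i ∈ S ω} = p) {c : V → ℝ} {f : Finset V → ℝ}
    (hf : ∀ a T, |f (insert a T) - f T| ≤ c a) {C : ℝ} (hC : 0 < C)
    (hc : ∑ a, c a ^ 2 ≤ 2 * C) {ε : ℝ} (hε : 0 ≤ ε) :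
    μ.real {ω | sampleMean p Finset.univ f + ε < f (sampled S ω)} ≤ Real.exp (-(ε ^ 2 / C)) := by
  classical
  set m := sampleMean p Finset.univ f with hm
  -- Chernoff parameter: it minimises the exponent -lε + C l²/4, with minimum -ε²/C.
  set l := 2 * ε / C with hl
  have hl0 : 0 ≤ l := by positivity
  rw [measureReal_sampled hmeas hindep hprob (fun T => m + ε < f T)]
  calc _ ≤ sampleMean p Finset.univ
          (fun T => Real.exp (f T * l) * Real.exp (-(l * (m + ε)))) := by
        refine sampleMean_mono hp0 hp1 _ fun T => ?_
        split_ifs with h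
        · rw [← Real.exp_add, Real.one_le_exp_iff]
          nlinarith
        · positivity
    _ = sampleMean p Finset.univ (fun T => Real.exp (f T * l)) * Real.exp (-(l * (m + ε))) :=
        sampleMean_mul_const _ _ _ _
    _ ≤ Real.exp (sampleMean p Finset.univ (fun T => f T * l) + (∑ a, (c a * l) ^ 2) / 8) *
          Real.exp (-(l * (m + ε))) := by
        refine mul_le_mul_of_nonneg_right ?_ (Real.exp_pos _).le
        refine sampleMean_exp_le hp0 hp1 _ _ _ fun a T => ?_
        rw [← sub_mul, abs_mul, abs_of_nonneg hl0]
        exact mul_le_mul_of_nonneg_right (hf a T) hl0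
    _ ≤ _ := by
        rw [sampleMean_mul_const, ← hm, ← Real.exp_add, Real.exp_le_exp]
        simp only [mul_pow, ← Finset.sum_mul]
        have h1 : (∑ a, c a ^ 2) * l ^ 2 ≤ 2 * C * l ^ 2 :=
          mul_le_mul_of_nonneg_right hc (sq_nonneg _)
        have h2 : 2 * C * l ^ 2 / 8 = ε ^ 2 / C := by rw [hl]; field_simp; ring
        have h3 : l * ε = 2 * (ε ^ 2 / C) := by rw [hl]; field_simp
        linarith

/-- The bounded differences inequality for a random set with independent memberships. -/
lemma one_sub_le_measureReal_abs_sub_sampleMean [IsProbabilityMeasure μ]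
    (hp0 : 0 ≤ p) (hp1 : p ≤ 1)
    (hmeas : ∀ i : V, MeasurableSet {ω | i ∈ S ω})
    (hindep : iIndepSet (fun i : V => {ω | i ∈ S ω}) μ)
    (hprob : ∀ i : V, μ.real {ω | i ∈ S ω} = p) {c : V → ℝ} {f : Finset V → ℝ}
    (hf : ∀ a T, |f (insert a T) - f T| ≤ c a) {C : ℝ} (hC : 0 < C)
    (hc : ∑ a, c a ^ 2 ≤ 2 * C) {δ : ℝ} (hδ0 : 0 < δ) (hδ1 : δ ≤ 1) :
    1 - δ ≤ μ.real {ω | |f (sampled S ω) - sampleMean p Finset.univ f| ≤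
      Real.sqrt (C * Real.log (2 / δ))} := by
  have hlog : 0 ≤ Real.log (2 / δ) := Real.log_nonneg (by rw [le_div_iff₀ hδ0]; linarith)
  set m := sampleMean p Finset.univ f with hm
  set ε := Real.sqrt (C * Real.log (2 / δ)) with hε
  -- Each of the two tails, for f and for -f, receives half of δ.
  have hexp : Real.exp (-(ε ^ 2 / C)) = δ / 2 := by
    rw [hε, Real.sq_sqrt (by positivity), mul_div_cancel_left₀ _ hC.ne', Real.exp_neg,
      Real.exp_log (by positivity), inv_div]
  have h1 := measureReal_upper_tail_le hp0 hp1 hmeas hindep hprob hf hC hc (Real.sqrt_nonneg _ : 0 ≤ ε)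
  have h2 := measureReal_upper_tail_le hp0 hp1 hmeas hindep hprob (f := fun T => f T * (-1))
    (c := c) (fun a T => by rw [← sub_mul, abs_mul]; simpa using hf a T) hC hc
    (Real.sqrt_nonneg _ : 0 ≤ ε)
  rw [sampleMean_mul_const] at h2
  rw [hexp] at h1 h2
  have hcompl := probReal_compl_eq_one_sub (μ := μ)
    (measurableSet_sampled hmeas fun T => |f T - m| ≤ ε)
  have hun : {ω | |f (sampled S ω) - m| ≤ ε}ᶜ ⊆
      {ω | m + ε < f (sampled S ω)} ∪ {ω | m * (-1) + ε < f (sampled S ω) * (-1)} := by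
    intro ω hω
    rw [Set.mem_compl_iff, Set.mem_ofPred_eq, not_le, lt_abs] at hω
    rcases hω with h | h
    · left
      rw [Set.mem_ofPred_eq]
      linarith
    · right
      rw [Set.mem_ofPred_eq]
      linarith
  have := (measureReal_mono hun (μ := μ)).trans (measureReal_union_le _ _)
  linarith

lemma sampleMean_mem [IsProbabilityMeasure μ]
    (hmeas : ∀ i : V, MeasurableSet {ω | i ∈ S ω})
    (hindep : iIndepSet (fun i : V => {ω | i ∈ S ω}) μ)
    (hprob : ∀ i : V, μ.real {ω | i ∈ S ω} = p) (i : V) :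
    sampleMean p Finset.univ (fun T => if i ∈ T then 1 else 0) = p := by
  rw [← measureReal_sampled hmeas hindep hprob (fun T => i ∈ T), ← hprob i]
  simp only [mem_sampled]

lemma sampleMean_mem_and_mem [IsProbabilityMeasure μ]
    (hmeas : ∀ i : V, MeasurableSet {ω | i ∈ S ω})
    (hindep : iIndepSet (fun i : V => {ω | i ∈ S ω}) μ)
    (hprob : ∀ i : V, μ.real {ω | i ∈ S ω} = p) {i j : V} (hij : i ≠ j) :
    sampleMean p Finset.univ (fun T => if i ∈ T ∧ j ∈ T then 1 else 0) = p ^ 2 := by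
  rw [← measureReal_sampled hmeas hindep hprob (fun T => i ∈ T ∧ j ∈ T)]
  have hset : {ω | i ∈ sampled S ω ∧ j ∈ sampled S ω} =
      ⋂ k ∈ ({i, j} : Finset V), {ω | k ∈ S ω} := by
    ext ω; simp [mem_sampled]
  rw [hset, measureReal_def, hindep.meas_biInter, ENNReal.toReal_prod, Finset.prod_pair hij,
    ← measureReal_def, ← measureReal_def, hprob, hprob, sq]

end Law

end MaxCutSDP

namespace MaxCutSDP

/-! ### The relaxation on induced subgraphs -/

section Relaxation

variable {V : Type*} {X : Matrix V V ℝ}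

lemma abs_apply_le_one_of_mem_feasible [Fintype V] (hX : X ∈ feasible V) (i j : V) :
    |X i j| ≤ 1 := by
  classical
  obtain ⟨hX, h1⟩ := hX
  have hs : X j i = X i j := by simpa using hX.1.apply i j
  -- The quadratic form of X at e_i + c e_j, with c = ±1.
  have key : ∀ c : ℝ, c * c = 1 → 0 ≤ 2 + 2 * c * X i j := by
    intro c hc
    have := (Matrix.posSemidef_iff_dotProduct_mulVec.1 hX).2 (Pi.single i 1 + Pi.single j c)
    simp [Matrix.mulVec_add, add_dotProduct, dotProduct_add, h1, hs] at this
    nlinarith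
  have h2 := key 1 (by norm_num)
  have h3 := key (-1) (by norm_num)
  rw [abs_le]
  constructor <;> linarith

/-- Take Y on the S block and the identity on the complement: a sum of two positive semidefinite
matrices. -/
lemma exists_feasible_extension [Fintype V] {S : Set V} {Y : Matrix S S ℝ} (hY : Y ∈ feasible S) :
    ∃ X ∈ feasible V, ∀ a b : S, X a b = Y a b := by
  classical
  set P : Matrix V S ℝ := (1 : Matrix V V ℝ).submatrix id Subtype.val with hP
  set D : Matrix V V ℝ := Matrix.diagonal fun i => if i ∈ S then 0 else 1 with hD
  have hblock (a b : S) : (P * Y * P.conjTranspose) a b = Y a b := by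
    simp [hP, Matrix.mul_apply, Matrix.one_apply, ← Subtype.ext_iff]
  have hzero (i : V) (hi : i ∉ S) : (P * Y * P.conjTranspose) i i = 0 := by
    have h (a : S) : i ≠ a := fun h => hi (h ▸ a.2)
    simp [hP, Matrix.mul_apply, Matrix.one_apply, h]
  have hDapp (a b : S) : D a b = 0 := by
    by_cases h : (a : V) = b <;> simp [hD, h]
  refine ⟨P * Y * P.conjTranspose + D, ⟨?_, fun i => ?_⟩, fun a b => ?_⟩
  · refine (hY.1.mul_mul_conjTranspose_same P).add (Matrix.PosSemidef.diagonal fun i => ?_)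
    dsimp only
    split_ifs <;> simp
  · by_cases hi : i ∈ S
    · have := hblock ⟨i, hi⟩ ⟨i, hi⟩
      have h' := hDapp ⟨i, hi⟩ ⟨i, hi⟩
      dsimp only at this h'
      rw [Matrix.add_apply, this, h', hY.2, add_zero]
    · rw [Matrix.add_apply, hzero i hi]
      simp [hD, hi]
  · rw [Matrix.add_apply, hblock, hDapp, add_zero]

/-- The objective of the relaxation on the vertices in `T`, for the adjacency matrix `A`. -/
noncomputable def cutForm (A : Matrix V V ℝ) (T : Finset V) (X : Matrix V V ℝ) : ℝ :=
  1 / 4 * ∑ i ∈ T, ∑ j ∈ T, A i j * (1 - X i j)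

/-- The unit diagonal of X turns the degree term of the Laplacian into the sum of the adjacency
entries. -/
lemma objective_weightedLap [Fintype V] (G : SimpleGraph V) (w : Sym2 V → ℝ)
    (hX : X ∈ feasible V) :
    objective (weightedLap G w) X = cutForm (weightedAdj G w) Finset.univ X := by
  classical
  rw [objective, cutForm]
  congr 1
  refine Finset.sum_congr rfl fun i _ => ?_
  simp only [weightedLap, Matrix.sub_apply, Matrix.diagonal_apply, sub_mul, mul_sub,
    Finset.sum_sub_distrib, ite_mul, zero_mul, Finset.sum_ite_eq, Finset.mem_univ, if_true,
    hX.2 i, mul_one]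

variable {G : SimpleGraph V} {w : Sym2 V → ℝ}

lemma weightedAdj_nonneg (hw : ∀ e ∈ G.edgeSet, 0 ≤ w e) (i j : V) : 0 ≤ weightedAdj G w i j := by
  rw [weightedAdj, Matrix.of_apply]
  split_ifs with h
  · exact hw _ h
  · exact le_rfl

lemma weightedAdj_self (i : V) : weightedAdj G w i i = 0 := by simp [weightedAdj]

lemma weightedAdj_comm (i j : V) : weightedAdj G w i j = weightedAdj G w j i := by
  simp only [weightedAdj, Matrix.of_apply, Sym2.eq_swap (a := i) (b := j)]
  by_cases h : G.Adj i j
  · rw [if_pos h, if_pos h.symm]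
  · rw [if_neg h, if_neg (mt SimpleGraph.Adj.symm h)]

lemma cutForm_insert [DecidableEq V] {T : Finset V} {a : V} (ha : a ∉ T) (hX : X ∈ feasible V) :
    cutForm (weightedAdj G w) (insert a T) X = cutForm (weightedAdj G w) T X +
      1 / 2 * ∑ j ∈ T, weightedAdj G w a j * (1 - X a j) := by
  have hs (j : V) : X j a = X a j := by simpa using hX.1.1.apply a j
  simp only [cutForm, Finset.sum_insert ha, weightedAdj_self, Finset.sum_add_distrib,
    weightedAdj_comm (G := G) (w := w) _ a, hs]
  ring

variable (G w)

lemma weightedAdj_induce (S : Set V) (i j : S) :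
    weightedAdj (G.induce S) (fun e => w (e.map Subtype.val)) i j = weightedAdj G w i j := by
  simp only [weightedAdj, Matrix.of_apply, Sym2.map_mk]
  by_cases h : G.Adj i j
  · rw [if_pos h, if_pos (SimpleGraph.induce_adj.2 h)]
  · rw [if_neg h, if_neg (mt SimpleGraph.induce_adj.1 h)]

lemma cutForm_induce (T : Finset V) [Fintype (T : Set V)] (X : Matrix V V ℝ) :
    cutForm (weightedAdj (G.induce (T : Set V)) fun e => w (e.map Subtype.val)) Finset.univ
      (X.submatrix Subtype.val Subtype.val) = cutForm (weightedAdj G w) T X := by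
  rw [cutForm, cutForm]
  congr 1
  rw [Finset.sum_subtype (F := inferInstance) T (p := (· ∈ (T : Set V))) (by simp)]
  refine Finset.sum_congr rfl fun i _ => ?_
  rw [Finset.sum_subtype (F := inferInstance) T (p := (· ∈ (T : Set V))) (by simp)]
  refine Finset.sum_congr rfl fun j _ => ?_
  rw [weightedAdj_induce, Matrix.submatrix_apply]

variable [Fintype V]

lemma cutForm_le_weightedSdp (hX : X ∈ feasible V) :
    cutForm (weightedAdj G w) Finset.univ X ≤ weightedSdp G w := by
  rw [← objective_weightedLap G w hX]
  exact (isGreatest_value _).2 ⟨X, hX, rfl⟩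

lemma exists_weightedSdp_eq :
    ∃ X ∈ feasible V, weightedSdp G w = cutForm (weightedAdj G w) Finset.univ X := by
  obtain ⟨X, hX, h⟩ := (isGreatest_value (weightedLap G w)).1
  exact ⟨X, hX, by rw [← objective_weightedLap G w hX, h]; rfl⟩

lemma weightedSdpOn_eq (S : Set V) [Fintype S] :
    weightedSdpOn G w S = weightedSdp (G.induce S) fun e => w (e.map Subtype.val) := by
  unfold weightedSdpOn
  congr!

lemma cutForm_le_weightedSdpOn (hX : X ∈ feasible V) (T : Finset V) :
    cutForm (weightedAdj G w) T X ≤ weightedSdpOn G w T := by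
  classical
  rw [weightedSdpOn_eq, ← cutForm_induce]
  exact cutForm_le_weightedSdp _ _ ⟨hX.1.submatrix Subtype.val, fun i => hX.2 i⟩

lemma exists_weightedSdpOn_eq (T : Finset V) :
    ∃ X ∈ feasible V, weightedSdpOn G w T = cutForm (weightedAdj G w) T X := by
  classical
  obtain ⟨Y, hY, h⟩ := exists_weightedSdp_eq (G.induce (T : Set V)) fun e => w (e.map Subtype.val)
  obtain ⟨X, hX, hXY⟩ := exists_feasible_extension hY
  refine ⟨X, hX, ?_⟩
  have : X.submatrix Subtype.val Subtype.val = Y := by ext a b; exact hXY a b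
  rw [weightedSdpOn_eq, ← cutForm_induce, this, ← h]

lemma weightedSdp_eq_weightedSdpOn_univ :
    weightedSdp G w = weightedSdpOn G w ((Finset.univ : Finset V) : Set V) := by
  obtain ⟨X, hX, h⟩ := exists_weightedSdp_eq G w
  obtain ⟨Y, hY, h'⟩ := exists_weightedSdpOn_eq G w Finset.univ
  exact le_antisymm (h.trans_le (cutForm_le_weightedSdpOn G w hX _))
    (h'.trans_le (cutForm_le_weightedSdp G w hY))

variable {G w}

/-- Test the optimiser of each set on the other. The objectives differ by half a row sum of A(1 -
X), and 0 ≤ 1 - X ≤ 2. -/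
lemma abs_weightedSdpOn_insert_sub_le [DecidableEq V] (hw : ∀ e ∈ G.edgeSet, 0 ≤ w e) (a : V)
    (T : Finset V) :
    |weightedSdpOn G w (insert a T : Finset V) - weightedSdpOn G w T| ≤
      ∑ j, weightedAdj G w a j := by
  have hA := weightedAdj_nonneg hw
  have hd : 0 ≤ ∑ j, weightedAdj G w a j := Finset.sum_nonneg fun j _ => hA a j
  by_cases ha : a ∈ T
  · simpa [Finset.insert_eq_of_mem ha] using hd
  have hrow {X : Matrix V V ℝ} (hX : X ∈ feasible V) :
      0 ≤ ∑ j ∈ T, weightedAdj G w a j * (1 - X a j) ∧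
      ∑ j ∈ T, weightedAdj G w a j * (1 - X a j) ≤ 2 * ∑ j, weightedAdj G w a j := by
    have hb (j : V) := abs_le.1 (abs_apply_le_one_of_mem_feasible hX a j)
    refine ⟨Finset.sum_nonneg fun j _ => mul_nonneg (hA a j) (by linarith [hb j]), ?_⟩
    calc _ ≤ ∑ j ∈ T, 2 * weightedAdj G w a j :=
          Finset.sum_le_sum fun j _ => by nlinarith [hb j, hA a j]
      _ ≤ ∑ j, 2 * weightedAdj G w a j :=
          Finset.sum_le_sum_of_subset_of_nonneg (Finset.subset_univ _)
            fun j _ _ => by linarith [hA a j]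
      _ = _ := by rw [Finset.mul_sum]
  obtain ⟨X, hX, h⟩ := exists_weightedSdpOn_eq G w (insert a T)
  obtain ⟨Y, hY, h'⟩ := exists_weightedSdpOn_eq G w T
  have h1 := cutForm_le_weightedSdpOn G w hX T
  have h2 := cutForm_le_weightedSdpOn G w hY (insert a T)
  rw [cutForm_insert ha hX] at h
  rw [cutForm_insert ha hY] at h2
  rw [abs_le]
  constructor <;> linarith [hrow hX, hrow hY]

/-- Handshake lemma: the adjacency entries sum over darts, and each edge carries two. -/
lemma sum_weightedAdj (G : SimpleGraph V) (w : Sym2 V → ℝ) :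
    ∑ i, ∑ j, weightedAdj G w i j = 2 * totalWeight G w := by
  classical
  have h1 : ∑ i, ∑ j, weightedAdj G w i j = ∑ d : G.Dart, w d.edge := by
    simp only [weightedAdj, Matrix.of_apply]
    rw [← Finset.sum_product', Finset.univ_product_univ, ← Finset.sum_filter]
    refine (Finset.sum_nbij (fun d : G.Dart => d.toProd) ?_ ?_ ?_ ?_).symm
    · intro d _
      simp
    · exact fun d _ e _ h => SimpleGraph.Dart.ext _ _ h
    · rintro ⟨i, j⟩ h
      exact ⟨⟨(i, j), by simpa using h⟩, by simp, rfl⟩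
    · intro d _
      rfl
  rw [h1, totalWeight, Finset.mul_sum,
    ← Finset.sum_fiberwise_of_maps_to (s := Finset.univ) (t := G.edgeFinset)
      (g := fun d : G.Dart => d.edge) (fun d _ => by simp)]
  refine Finset.sum_congr rfl fun e he => ?_
  rw [Finset.sum_congr rfl (g := fun _ => w e)
    fun d hd => by rw [(Finset.mem_filter.1 hd).2], Finset.sum_const,
    G.dart_edge_fiber_card e (by simpa using he)]
  simp

lemma totalWeight_nonneg (hw : ∀ e ∈ G.edgeSet, 0 ≤ w e) : 0 ≤ totalWeight G w :=
  Finset.sum_nonneg fun e he => hw e (by simpa using he)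

/-- Row a and column a are disjoint parts of the full sum 2W, because the diagonal vanishes. -/
lemma weightedDegree_le_totalWeight (hw : ∀ e ∈ G.edgeSet, 0 ≤ w e) (a : V) :
    ∑ j, weightedAdj G w a j ≤ totalWeight G w := by
  classical
  have hA := weightedAdj_nonneg hw
  have h := sum_weightedAdj G w
  rw [← Finset.add_sum_erase _ _ (Finset.mem_univ a)] at h
  have h1 : ∑ i ∈ Finset.univ.erase a, weightedAdj G w i a ≤
      ∑ i ∈ Finset.univ.erase a, ∑ j, weightedAdj G w i j :=
    Finset.sum_le_sum fun i _ =>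
      Finset.single_le_sum (f := weightedAdj G w i) (fun j _ => hA i j) (Finset.mem_univ a)
  have h2 : ∑ i ∈ Finset.univ.erase a, weightedAdj G w i a = ∑ j, weightedAdj G w a j := by
    rw [← Finset.add_sum_erase _ (weightedAdj G w a) (Finset.mem_univ a), weightedAdj_self, zero_add]
    exact Finset.sum_congr rfl fun i _ => weightedAdj_comm _ _
  linarith

lemma sum_sq_weightedDegree_le (hw : ∀ e ∈ G.edgeSet, 0 ≤ w e) :
    ∑ a, (∑ j, weightedAdj G w a j) ^ 2 ≤ 2 * totalWeight G w ^ 2 := by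
  calc _ ≤ ∑ a, totalWeight G w * ∑ j, weightedAdj G w a j := by
        refine Finset.sum_le_sum fun a _ => ?_
        rw [sq]
        exact mul_le_mul_of_nonneg_right (weightedDegree_le_totalWeight hw a)
          (Finset.sum_nonneg fun j _ => weightedAdj_nonneg hw a j)
    _ = _ := by rw [← Finset.mul_sum, sum_weightedAdj]; ring

end Relaxation

end MaxCutSDP

namespace MaxCutSDP

/-! ### Bias of the sampled value -/

section Expectation

variable {V : Type*} [Fintype V] [DecidableEq V] {p : ℝ}

/-- The zero diagonal matters: a pair i = j would survive with probability p, not p². -/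
lemma sampleMean_sum_sum
    (h2 : ∀ i j : V, i ≠ j →
      sampleMean p Finset.univ (fun T => if i ∈ T ∧ j ∈ T then 1 else 0) = p ^ 2)
    {B : V → V → ℝ} (hB : ∀ i, B i i = 0) :
    sampleMean p Finset.univ (fun T => ∑ i ∈ T, ∑ j ∈ T, B i j) = p ^ 2 * ∑ i, ∑ j, B i j := by
  have hT (T : Finset V) : ∑ i ∈ T, ∑ j ∈ T, B i j =
      ∑ i, ∑ j, B i j * (if i ∈ T ∧ j ∈ T then 1 else 0) := by
    simp only [mul_ite, mul_one, mul_zero, ite_and, Finset.sum_ite_mem, Finset.sum_ite_irrel,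
      Finset.sum_const_zero, Finset.univ_inter]
  rw [funext hT]
  simp only [sampleMean, Finset.mul_sum]
  rw [Finset.sum_comm]
  refine Finset.sum_congr rfl fun i _ => ?_
  rw [Finset.sum_comm]
  refine Finset.sum_congr rfl fun j _ => ?_
  by_cases hij : i = j
  · simp [hij, hB]
  · rw [← h2 i j hij, sampleMean, Finset.sum_mul]
    exact Finset.sum_congr rfl fun T _ => by ring

end Expectation

section Bias

variable {V : Type*} [Fintype V] [DecidableEq V] {p : ℝ} (G : SimpleGraph V) (w : Sym2 V → ℝ)

lemma sq_mul_weightedSdp_le_sampleMean (hp0 : 0 ≤ p) (hp1 : p ≤ 1)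
    (h2 : ∀ i j : V, i ≠ j →
      sampleMean p Finset.univ (fun T => if i ∈ T ∧ j ∈ T then 1 else 0) = p ^ 2) :
    p ^ 2 * weightedSdp G w ≤ sampleMean p Finset.univ (fun T : Finset V => weightedSdpOn G w T) := by
  obtain ⟨X, hX, h⟩ := exists_weightedSdp_eq G w
  calc _ = sampleMean p Finset.univ fun T => cutForm (weightedAdj G w) T X := by
        simp only [cutForm, mul_comm (1 / 4 : ℝ)] at h ⊢
        rw [sampleMean_mul_const, sampleMean_sum_sum h2 fun i => by rw [weightedAdj_self, zero_mul],
          h, mul_assoc]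
    _ ≤ _ := sampleMean_mono hp0 hp1 _ fun T => cutForm_le_weightedSdpOn G w hX T

lemma sampleMean_weightedSdpOn_le (hp0 : 0 < p) (hp1 : p ≤ 1)
    (h1 : ∀ i : V, sampleMean p Finset.univ (fun T => if i ∈ T then 1 else 0) = p)
    (h2 : ∀ i j : V, i ≠ j →
      sampleMean p Finset.univ (fun T => if i ∈ T ∧ j ∈ T then 1 else 0) = p ^ 2) :
    sampleMean p Finset.univ (fun T : Finset V => weightedSdpOn G w T) ≤
      p * weightedSdp G w - p * (1 - p) * (totalWeight G w / 2) := by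
  choose X hX hval using exists_weightedSdpOn_eq G w
  set A := weightedAdj G w with hA
  let q : Finset V → ℝ := fun T => ∏ i, if i ∈ T then p else 1 - p
  have hq (T : Finset V) : 0 ≤ q T := Finset.prod_nonneg fun i _ => by split_ifs <;> linarith
  let D : Finset V → Matrix V V ℝ := fun T => Matrix.diagonal fun i => if i ∈ T then 1 else 0
  let M : Finset V → Matrix V V ℝ := fun T => D T * X T * (D T).conjTranspose
  have hM (T : Finset V) (i j : V) : M T i j = if i ∈ T ∧ j ∈ T then X T i j else 0 := by
    simp only [M, D, Matrix.diagonal_conjTranspose, Matrix.mul_diagonal, Matrix.diagonal_mul]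
    by_cases hi : i ∈ T <;> by_cases hj : j ∈ T <;> simp [hi, hj]
  -- Averaged zero-padded optimisers; the factor p⁻¹ restores the unit diagonal.
  let Z : Matrix V V ℝ := p⁻¹ • ∑ T, q T • M T
  have hZ (i j : V) : p * Z i j = ∑ T, q T * M T i j := by
    simp only [Z, Matrix.smul_apply, Matrix.sum_apply, smul_eq_mul]
    rw [mul_inv_cancel_left₀ hp0.ne']
  have hZf : Z ∈ feasible V := by
    refine ⟨Matrix.PosSemidef.smul (Matrix.posSemidef_sum _ fun T _ =>
      (((hX T).1.mul_mul_conjTranspose_same (D T)).smul (hq T))) (inv_nonneg.2 hp0.le),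
      fun i => ?_⟩
    have h : p * Z i i = p := by
      rw [hZ]
      conv_rhs => rw [← h1 i, sampleMean, Finset.powerset_univ]
      refine Finset.sum_congr rfl fun T _ => ?_
      rw [hM, (hX T).2]
      simp [q]
    exact mul_left_cancel₀ hp0.ne' (by rw [h, mul_one])
  have hle := cutForm_le_weightedSdp G w hZf
  have hW := sum_weightedAdj G w
  rw [← hA] at hle hW
  have hcutZ : cutForm A Finset.univ Z =
      1 / 4 * (2 * totalWeight G w) - 1 / 4 * ∑ i, ∑ j, A i j * Z i j := by
    simp only [cutForm, mul_sub, mul_one, Finset.sum_sub_distrib, hW]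
  have hsum (T : Finset V) : ∑ i ∈ T, ∑ j ∈ T, A i j * X T i j = ∑ i, ∑ j, A i j * M T i j := by
    simp only [hM, mul_ite, mul_zero, ite_and, Finset.sum_ite_mem, Finset.sum_ite_irrel,
      Finset.sum_const_zero, Finset.univ_inter]
  have hcutT (T : Finset V) : weightedSdpOn G w T =
      1 / 4 * (∑ i ∈ T, ∑ j ∈ T, A i j) - 1 / 4 * ∑ i, ∑ j, A i j * M T i j := by
    rw [hval, ← hsum]
    simp only [cutForm, mul_sub, mul_one, Finset.sum_sub_distrib]
  have hswap : ∑ T, q T * ∑ i, ∑ j, A i j * M T i j = p * ∑ i, ∑ j, A i j * Z i j := by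
    simp only [Finset.mul_sum]
    rw [Finset.sum_comm]
    refine Finset.sum_congr rfl fun i _ => ?_
    rw [Finset.sum_comm]
    refine Finset.sum_congr rfl fun j _ => ?_
    rw [mul_left_comm, hZ, Finset.mul_sum]
    exact Finset.sum_congr rfl fun T _ => by ring
  have hquad : ∑ T, q T * ∑ i ∈ T, ∑ j ∈ T, A i j = p ^ 2 * (2 * totalWeight G w) := by
    rw [← hW, ← sampleMean_sum_sum h2 fun i => weightedAdj_self i, sampleMean,
      Finset.powerset_univ]
  -- The constant part scales by p² but the part linear in Z only by p; this mismatch yields p(1-p)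
  -- W/2.
  have hmean : sampleMean p Finset.univ (fun T : Finset V => weightedSdpOn G w T) =
      1 / 4 * (p ^ 2 * (2 * totalWeight G w)) - 1 / 4 * (p * ∑ i, ∑ j, A i j * Z i j) := by
    rw [← hquad, ← hswap, Finset.mul_sum, Finset.mul_sum, ← Finset.sum_sub_distrib, sampleMean,
      Finset.powerset_univ]
    refine Finset.sum_congr rfl fun T _ => ?_
    rw [hcutT]
    ring
  rw [hmean]
  have := mul_le_mul_of_nonneg_left (hcutZ.symm.trans_le hle) hp0.le
  linarith

end Bias

/-! ### Assembling bias and concentration -/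

section Main

variable {V : Type*} [Fintype V] {Ω : Type*} [MeasurableSpace Ω] {μ : Measure Ω}
  [IsProbabilityMeasure μ] {t : ℝ} {S : Ω → Set V} {δ : ℝ} {G : SimpleGraph V} {w : Sym2 V → ℝ}

/-- Sampling bound for the relaxation, in terms of a bound `2 * C` on the sum of the squared
weighted degrees. -/
lemma one_sub_le_measureReal_abs_weightedSdp_sub (ht0 : 0 < t) (htn : t ≤ Fintype.card V)
    (hmeas : ∀ i : V, MeasurableSet {ω | i ∈ S ω})
    (hindep : iIndepSet (fun i : V => {ω | i ∈ S ω}) μ)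
    (hprob : ∀ i : V, μ.real {ω | i ∈ S ω} = t / Fintype.card V)
    (hδ0 : 0 < δ) (hδ1 : δ ≤ 1) (hw : ∀ e ∈ G.edgeSet, 0 ≤ w e) {C : ℝ} (hC : 0 < C)
    (hc : ∑ a, (∑ j, weightedAdj G w a j) ^ 2 ≤ 2 * C) :
    1 - δ ≤ μ.real {ω |
      |1 / (Fintype.card V : ℝ) ^ 2 * weightedSdp G w - 1 / t ^ 2 * weightedSdpOn G w (S ω)| ≤
        ((Fintype.card V : ℝ) - t) / ((Fintype.card V : ℝ) ^ 2 * t) *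
            (weightedSdp G w - totalWeight G w / 2) +
          Real.sqrt (C * Real.log (2 / δ)) / t ^ 2} := by
  classical
  set n : ℝ := (Fintype.card V : ℝ) with hn
  have hn0 : 0 < n := ht0.trans_le htn
  have hp0 : 0 < t / n := by positivity
  have hp1 : t / n ≤ 1 := by rw [div_le_one hn0]; exact htn
  have h1 : ∀ i : V, sampleMean (t / n) Finset.univ (fun T => if i ∈ T then 1 else 0) = t / n :=
    fun i => sampleMean_mem hmeas hindep hprob i
  have h2 : ∀ i j : V, i ≠ j →
      sampleMean (t / n) Finset.univ (fun T => if i ∈ T ∧ j ∈ T then 1 else 0) = (t / n) ^ 2 :=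
    fun i j hij => sampleMean_mem_and_mem hmeas hindep hprob hij
  have hlow := sq_mul_weightedSdp_le_sampleMean G w hp0.le hp1 h2
  have hup := sampleMean_weightedSdpOn_le G w hp0 hp1 h1 h2
  refine (one_sub_le_measureReal_abs_sub_sampleMean hp0.le hp1 hmeas hindep hprob
    (f := fun T => weightedSdpOn G w T)
    (fun a T => abs_weightedSdpOn_insert_sub_le hw a T) hC hc hδ0 hδ1).trans
    (measureReal_mono fun ω hω => ?_)
  rw [Set.mem_ofPred_eq] at hω ⊢
  rw [coe_sampled] at hω
  set m := sampleMean (t / n) Finset.univ (fun T : Finset V => weightedSdpOn G w T)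
  set ε := Real.sqrt (C * Real.log (2 / δ))
  set F := weightedSdpOn G w (S ω)
  set s := weightedSdp G w
  set W := totalWeight G w
  have hlow' : 1 / n ^ 2 * s ≤ m / t ^ 2 := by
    rw [le_div_iff₀ (by positivity)]
    refine le_of_eq_of_le ?_ hlow
    field_simp
  -- With p = t/n, p/t² = 1/n² + (n-t)/(n²t) and p(1-p)/t² = (n-t)/(n²t).
  have hup' : m / t ^ 2 ≤ 1 / n ^ 2 * s + (n - t) / (n ^ 2 * t) * (s - W / 2) := by
    rw [div_le_iff₀ (by positivity)]
    refine hup.trans_eq ?_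
    field_simp
    ring
  have hdev : |F / t ^ 2 - m / t ^ 2| ≤ ε / t ^ 2 := by
    rw [← sub_div, abs_div, abs_of_pos (by positivity : 0 < t ^ 2)]
    gcongr
  have hF : 1 / t ^ 2 * F = F / t ^ 2 := by ring
  rw [abs_le] at hdev ⊢
  rw [hF]
  constructor <;> linarith

lemma sdp_eq_weightedSdp_one (G : SimpleGraph V) : sdp G = weightedSdp G fun _ => 1 := by
  classical
  rw [sdp, weightedSdp]
  congr 1
  ext i j
  simp only [SimpleGraph.lapMatrix, SimpleGraph.degMatrix, weightedLap, Matrix.sub_apply,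
    Matrix.diagonal_apply, weightedAdj, Matrix.of_apply, SimpleGraph.adjMatrix_apply]
  congr 1
  by_cases hij : i = j
  · simp [hij, SimpleGraph.degree, SimpleGraph.neighborFinset_eq_filter]
  · simp [hij]

lemma sdpOn_eq_weightedSdpOn_one (G : SimpleGraph V) (S : Set V) :
    sdpOn G S = weightedSdpOn G (fun _ => 1) S := by
  classical
  exact sdp_eq_weightedSdp_one _

lemma totalWeight_one (G : SimpleGraph V) : totalWeight G (fun _ => 1) = G.edgeSet.ncard := by
  classical
  rw [totalWeight, Finset.sum_const, nsmul_one, ← SimpleGraph.coe_edgeFinset,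
    Set.ncard_coe_finset]

lemma weightedSdpOn_eq_zero_of_totalWeight (hw : ∀ e ∈ G.edgeSet, 0 ≤ w e)
    (hW : totalWeight G w = 0) (T : Finset V) : weightedSdpOn G w T = 0 := by
  have hA (i j : V) : weightedAdj G w i j = 0 := by
    have h0 := weightedAdj_nonneg hw
    refine le_antisymm ?_ (h0 i j)
    rw [← hW]
    exact (Finset.single_le_sum (fun k _ => h0 i k) (Finset.mem_univ j)).trans
      (weightedDegree_le_totalWeight hw i)
  obtain ⟨X, -, h⟩ := exists_weightedSdpOn_eq G w T
  simp [h, cutForm, hA]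

end Main

end MaxCutSDP

theorem theoremE {V : Type*} [Fintype V] (G : SimpleGraph V)
    {Ω : Type*} [MeasurableSpace Ω] (μ : Measure Ω) [IsProbabilityMeasure μ]
    (t : ℝ) (ht0 : 0 < t) (htn : t ≤ Fintype.card V)
    (S : Ω → Set V)
    (hmeas : ∀ i : V, MeasurableSet {ω | i ∈ S ω})
    (hindep : iIndepSet (fun i : V => {ω | i ∈ S ω}) μ)
    (hprob : ∀ i : V, μ.real {ω | i ∈ S ω} = t / Fintype.card V)
    (δ : ℝ) (hδ0 : 0 < δ) (hδ1 : δ ≤ 1) :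
    (1 - δ ≤ μ.real {ω |
      |1 / (Fintype.card V : ℝ) ^ 2 * MaxCutSDP.sdp G - 1 / t ^ 2 * MaxCutSDP.sdpOn G (S ω)| ≤
        ((Fintype.card V : ℝ) - t) / ((Fintype.card V : ℝ) ^ 2 * t) *
            (MaxCutSDP.sdp G - (G.edgeSet.ncard : ℝ) / 2) +
          Real.sqrt ((Fintype.card V : ℝ) ^ 3 / t ^ 4 * Real.log (2 / δ))}) ∧
    (∀ w : Sym2 V → ℝ, (∀ e ∈ G.edgeSet, 0 ≤ w e) →
      1 - δ ≤ μ.real {ω |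
        |1 / (Fintype.card V : ℝ) ^ 2 * MaxCutSDP.weightedSdp G w -
            1 / t ^ 2 * MaxCutSDP.weightedSdpOn G w (S ω)| ≤
          ((Fintype.card V : ℝ) - t) / ((Fintype.card V : ℝ) ^ 2 * t) *
              (MaxCutSDP.weightedSdp G w - MaxCutSDP.totalWeight G w / 2) +
            MaxCutSDP.totalWeight G w / t ^ 2 * Real.sqrt (Real.log (2 / δ))}) := by
  classical
  open MaxCutSDP in
  constructor
  · have hn0 : 0 < (Fintype.card V : ℝ) := ht0.trans_le htn
    have hdeg (a : V) : ∑ j, weightedAdj G (fun _ => 1) a j ≤ Fintype.card V := by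
      refine (Finset.sum_le_sum (g := fun _ => 1) fun j _ => ?_).trans_eq (by simp)
      rw [weightedAdj, Matrix.of_apply]
      split_ifs <;> norm_num
    -- Bounding every degree by n already gives n³, so C = n³ leaves a factor 2 to spare.
    have hc : ∑ a, (∑ j, weightedAdj G (fun _ => 1) a j) ^ 2 ≤ 2 * (Fintype.card V : ℝ) ^ 3 := by
      calc _ ≤ ∑ _a : V, (Fintype.card V : ℝ) ^ 2 :=
            Finset.sum_le_sum fun a _ => pow_le_pow_left₀
              (Finset.sum_nonneg fun j _ => weightedAdj_nonneg (by simp) a j) (hdeg a) 2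
        _ = (Fintype.card V : ℝ) ^ 3 := by simp; ring
        _ ≤ _ := by linarith [pow_pos hn0 3]
    have h := one_sub_le_measureReal_abs_weightedSdp_sub (w := fun _ => 1) ht0 htn hmeas hindep
      hprob hδ0 hδ1 (by simp) (pow_pos hn0 3) hc
    have hsqrt : Real.sqrt ((Fintype.card V : ℝ) ^ 3 / t ^ 4 * Real.log (2 / δ)) =
        Real.sqrt ((Fintype.card V : ℝ) ^ 3 * Real.log (2 / δ)) / t ^ 2 := by
      rw [div_mul_eq_mul_div, Real.sqrt_div' _ (by positivity), show t ^ 4 = (t ^ 2) ^ 2 by ring,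
        Real.sqrt_sq (by positivity)]
    simpa only [sdp_eq_weightedSdp_one, sdpOn_eq_weightedSdpOn_one, ← totalWeight_one, hsqrt]
      using h
  · intro w hw
    -- The concentration bound takes C = W² and needs C > 0; if W = 0, all the values vanish.
    rcases (totalWeight_nonneg hw).eq_or_lt with hW | hW
    · have hF := weightedSdpOn_eq_zero_of_totalWeight hw hW.symm
      have hS (ω : Ω) : weightedSdpOn G w (S ω) = 0 := by rw [← coe_sampled S ω, hF]
      rw [weightedSdp_eq_weightedSdpOn_univ, hF]
      simp [hS, ← hW, hδ0.le]
    · have h := one_sub_le_measureReal_abs_weightedSdp_sub ht0 htn hmeas hindep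
        hprob hδ0 hδ1 hw (pow_pos hW 2) (sum_sq_weightedDegree_le hw)
      rwa [Real.sqrt_mul (by positivity), Real.sqrt_sq hW.le, mul_div_right_comm] at h
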